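/- Let $1\le n\le K$ be integers, let $V$ be an $\mathbb{R}^n$-valued random vector with $\mathbb{E}\|V\|^2<\infty$ that is not almost surely constant, and let $R_V\subseteq\mathbb{R}^n$ be the support of its distribution. A \emph{dictionary} is a family $(d_i)_{i=1}^K$ of vectors in $\mathbb{R}^n$ with $\langle d_i,d_i\rangle=1$ for all $i$ (all prescribed lengths equal $1$). Consider the problem of minimizing $$\mathbb{E}\big[\langle f(V),f(V)\rangle\big]$$ over all triples $(c,(d_i)_{i=1}^K,f)$, where $c\in\mathbb{R}^n$, $(d_i)_{i=1}^K$ is a dictionary whose linear span contains $\{v\in\mathbb{R}^n : v+c\in R_V\}$, and $f:\mathbb{R}^n\to\mathbb{R}^K$ is a measurable map with $V-c=\sum_{i=1}^K f_i(V)\,d_i$ almost surely. A dictionary $(d_i)_{i=1}^K$ is called \emph{$\ell_2$-optimal} if there exist $c$ and $f$ such that $(c,(d_i)_{i=1}^K,f)$ is a minimizer of this problem. Let $\Sigma^*=\mathrm{Var}(V)=\mathbb{E}\big[(V-\mathbb{E}V)(V-\mathbb{E}V)^\top\big]$, and let ${\Sigma^*}^{1/2}$ be its positive semidefinite square root. Then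 a dictionary $(d_i)_{i=1}^K$ is $\ell_2$-optimal if and only if $$\sum_{i=1}^K d_i d_i^\top=\frac{K}{\operatorname{tr}\big({\Sigma^*}^{1/2}\big)}\,{\Sigma^*}^{1/2}.$$ -/

import Mathlib

open MeasureTheory ProbabilityTheory
open scoped ENNReal MatrixOrder

namespace L2Dictionary

variable {Ω : Type*} [MeasurableSpace Ω] {n K : ℕ}

/-- The support `R_V` of the law of the random vector `V`. -/
def lawSupport (P : Measure Ω) (V : Ω → EuclideanSpace ℝ (Fin n)) :
    Set (EuclideanSpace ℝ (Fin n)) :=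
  (P.map V).support

/-- The shifted support `R_V(c) = {v | v + c ∈ R_V}`. -/
def shiftedSupport (P : Measure Ω) (V : Ω → EuclideanSpace ℝ (Fin n))
    (c : EuclideanSpace ℝ (Fin n)) : Set (EuclideanSpace ℝ (Fin n)) :=
  {v | v + c ∈ lawSupport P V}

/-- A family of `K` vectors of `ℝⁿ` is a dictionary with prescribed squared lengths `ℓ`
if `⟨d i, d i⟩ = ℓ i` for all `i`. -/
def IsDictionary (ℓ : Fin K → ℝ) (d : Fin K → EuclideanSpace ℝ (Fin n)) : Prop :=
  ∀ i, inner ℝ (d i) (d i) = ℓ i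

/-- The dictionary `d` is feasible for the constant `c`: it has the prescribed lengths and
its span contains `R_V(c)`. -/
def IsFeasibleDictionary (P : Measure Ω) (V : Ω → EuclideanSpace ℝ (Fin n)) (ℓ : Fin K → ℝ)
    (c : EuclideanSpace ℝ (Fin n)) (d : Fin K → EuclideanSpace ℝ (Fin n)) : Prop :=
  IsDictionary ℓ d ∧
    shiftedSupport P V c ⊆ (Submodule.span ℝ (Set.range d) : Set (EuclideanSpace ℝ (Fin n)))

/-- The scheme of representation `f` is feasible for the constant `c` and the dictionary `d`:
`f` is (Borel) measurable and `V - c = ∑ i, f(V)_i d_i` almost surely. -/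
def IsFeasibleScheme (P : Measure Ω) (V : Ω → EuclideanSpace ℝ (Fin n))
    (c : EuclideanSpace ℝ (Fin n)) (d : Fin K → EuclideanSpace ℝ (Fin n))
    (f : EuclideanSpace ℝ (Fin n) → EuclideanSpace ℝ (Fin K)) : Prop :=
  Measurable f ∧ ∀ᵐ ω ∂P, V ω - c = ∑ i, f (V ω) i • d i

/-- The triple `(c, d, f)` satisfies the constraints of the `ℓ₂`-optimal dictionary problem. -/
def IsFeasible (P : Measure Ω) (V : Ω → EuclideanSpace ℝ (Fin n)) (ℓ : Fin K → ℝ)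
    (c : EuclideanSpace ℝ (Fin n)) (d : Fin K → EuclideanSpace ℝ (Fin n))
    (f : EuclideanSpace ℝ (Fin n) → EuclideanSpace ℝ (Fin K)) : Prop :=
  IsFeasibleDictionary P V ℓ c d ∧ IsFeasibleScheme P V c d f

/-- The average cost `𝔼[⟨f(V), f(V)⟩]` of the scheme `f`, with value `∞` if it is infinite. -/
noncomputable def cost (P : Measure Ω) (V : Ω → EuclideanSpace ℝ (Fin n))
    (f : EuclideanSpace ℝ (Fin n) → EuclideanSpace ℝ (Fin K)) : ℝ≥0∞ :=
  ∫⁻ ω, ENNReal.ofReal (inner ℝ (f (V ω)) (f (V ω))) ∂P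

/-- The triple `(c, d, f)` is a global minimizer of the `ℓ₂`-optimal dictionary problem. -/
def IsOptimalTriple (P : Measure Ω) (V : Ω → EuclideanSpace ℝ (Fin n)) (ℓ : Fin K → ℝ)
    (c : EuclideanSpace ℝ (Fin n)) (d : Fin K → EuclideanSpace ℝ (Fin n))
    (f : EuclideanSpace ℝ (Fin n) → EuclideanSpace ℝ (Fin K)) : Prop :=
  IsFeasible P V ℓ c d f ∧
    ∀ (c' : EuclideanSpace ℝ (Fin n)) (d' : Fin K → EuclideanSpace ℝ (Fin n))
      (f' : EuclideanSpace ℝ (Fin n) → EuclideanSpace ℝ (Fin K)),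
      IsFeasible P V ℓ c' d' f' → cost P V f ≤ cost P V f'

/-- The dictionary `d` is `ℓ₂`-optimal: it is the dictionary component of a global minimizer. -/
def IsL2Optimal (P : Measure Ω) (V : Ω → EuclideanSpace ℝ (Fin n)) (ℓ : Fin K → ℝ)
    (d : Fin K → EuclideanSpace ℝ (Fin n)) : Prop :=
  ∃ (c : EuclideanSpace ℝ (Fin n))
    (f : EuclideanSpace ℝ (Fin n) → EuclideanSpace ℝ (Fin K)), IsOptimalTriple P V ℓ c d f

/-- The variance (covariance matrix) `𝔼[(V - 𝔼 V)(V - 𝔼 V)ᵀ]` of the random vector `V`. -/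
noncomputable def varMatrix (P : Measure Ω) (V : Ω → EuclideanSpace ℝ (Fin n)) :
    Matrix (Fin n) (Fin n) ℝ :=
  Matrix.of fun i j => cov[fun ω => V ω i, fun ω => V ω j; P]

end L2Dictionary

/-! Write `A` for the square root of the covariance, `B` for its pseudo-inverse, `W = V - 𝔼V`, `D`
for the matrix with columns `d i`, `S = D Dᵀ` and `λ = tr A / K`. Since `D f` is `W` plus a
constant, completing the square around the linear scheme `λ Dᵀ B W` gives, for every feasible triple
of finite cost, `cost = (tr A)² / K + 𝔼‖f - λ Dᵀ B W‖² + λ² ∑ ‖(1 - A B) d i‖²` (`cost_toReal_eq`).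
Hence `(tr A)² / K` is a lower bound, and equality forces `λ S = A` (`frame_eq_of_cost_le`).
Conversely, if `λ S = A`, the linear scheme with `c = 𝔼V` attains the bound
(`exists_isFeasible_cost_eq`). Such unit dictionaries exist because `n ≤ K` (`exists_unit_frame`),
so the bound is the true minimum. -/

namespace L2Dictionary

variable {Ω : Type*} [MeasurableSpace Ω] {n K : ℕ}

open Matrix

/-! ### Matrix preliminaries: pseudo-inverse and unit-norm frames. -/

/-- A real symmetric matrix has a symmetric pseudo-inverse commuting with it. -/
theorem exists_pseudoinverse {A : Matrix (Fin n) (Fin n) ℝ} (hA : A.IsHermitian) :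
    ∃ B : Matrix (Fin n) (Fin n) ℝ, Bᵀ = B ∧ A * B = B * A ∧ A * B * A = A := by
  have hsa : IsSelfAdjoint A := hA
  have hfin : (spectrum ℝ A).Finite := Matrix.finite_real_spectrum
  -- A finite spectrum makes even `x⁻¹` continuous on it; with `0⁻¹ = 0` it yields the Moore–Penrose
  -- inverse.
  have hc : ∀ f : ℝ → ℝ, ContinuousOn f (spectrum ℝ A) := fun f => hfin.continuousOn f
  have hBA : cfc (fun x : ℝ => x⁻¹ * x) A = cfc (fun x : ℝ => x⁻¹) A * A := by
    rw [cfc_mul _ _ A (hc _) (hc _), cfc_id' ℝ A]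
  have hAB : cfc (fun x : ℝ => x * x⁻¹) A = A * cfc (fun x : ℝ => x⁻¹) A := by
    rw [cfc_mul _ _ A (hc _) (hc _), cfc_id' ℝ A]
  have hABA : cfc (fun x : ℝ => x * x⁻¹ * x) A = A * cfc (fun x : ℝ => x⁻¹) A * A := by
    rw [cfc_mul _ _ A (hc _) (hc _), cfc_id' ℝ A, hAB]
  refine ⟨cfc (fun x : ℝ => x⁻¹) A, ?_, ?_, ?_⟩
  · have : IsSelfAdjoint (cfc (fun x : ℝ => x⁻¹) A) := cfc_predicate _ A
    simpa [IsSelfAdjoint, star_eq_conjTranspose] using this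
  · rw [← hAB, ← hBA]; simp only [mul_comm]
  · rw [← hABA]; simp only [mul_inv_mul_cancel]; exact cfc_id' ℝ A

/-- The rotation of two vectors by an angle preserves the sum of their outer squares. -/
theorem exists_rotation {d e : Fin n → ℝ} (hd : d ⬝ᵥ d < 1) (he : 1 < e ⬝ᵥ e) :
    ∃ d' e' : Fin n → ℝ, d' ⬝ᵥ d' = 1 ∧
      vecMulVec d' d' + vecMulVec e' e' = vecMulVec d d + vecMulVec e e := by
  let u : ℝ → Fin n → ℝ := fun t => Real.cos t • d + Real.sin t • e
  have hu : Continuous fun t => u t ⬝ᵥ u t := by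
    simp only [u, dotProduct]
    fun_prop
  have hmem : (1 : ℝ) ∈ Set.Icc (u 0 ⬝ᵥ u 0) (u (Real.pi / 2) ⬝ᵥ u (Real.pi / 2)) := by
    simp [u, hd.le, he.le]
  obtain ⟨t, -, ht⟩ := intermediate_value_Icc (by positivity) hu.continuousOn hmem
  refine ⟨u t, -Real.sin t • d + Real.cos t • e, ht, ?_⟩
  ext i j
  simp only [u, vecMulVec_apply, Matrix.add_apply, Pi.add_apply, Pi.smul_apply, smul_eq_mul]
  linear_combination (d i * d j + e i * e j) * Real.sin_sq_add_cos_sq t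

/-- A family of vectors whose squared lengths average to `1` can be replaced by a family of
unit vectors with the same sum of outer squares. -/
theorem exists_unit_family (d : Fin K → Fin n → ℝ) (hd : ∑ i, d i ⬝ᵥ d i = K) :
    ∃ d' : Fin K → Fin n → ℝ, (∀ i, d' i ⬝ᵥ d' i = 1) ∧
      ∑ i, vecMulVec (d' i) (d' i) = ∑ i, vecMulVec (d i) (d i) := by
  classical
  -- Induction on the number of non-unit vectors: rotating a short one against a long one makes at
  -- least one of them unit.
  induction hm : (Finset.univ.filter fun i => d i ⬝ᵥ d i ≠ 1).card using
    Nat.strong_induction_on generalizing d with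
  | _ m ih =>
    by_cases hall : ∀ i, d i ⬝ᵥ d i = 1
    · exact ⟨d, hall, rfl⟩
    have hsum : ∑ i, d i ⬝ᵥ d i = ∑ _i : Fin K, (1 : ℝ) := by simpa using hd
    have hlt : ∃ i, d i ⬝ᵥ d i < 1 := by
      by_contra! h
      exact hall fun i => ((Finset.sum_eq_sum_iff_of_le fun i _ => h i).1 hsum.symm i
        (Finset.mem_univ i)).symm
    have hgt : ∃ i, 1 < d i ⬝ᵥ d i := by
      by_contra! h
      exact hall fun i => (Finset.sum_eq_sum_iff_of_le fun i _ => h i).1 hsum i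
        (Finset.mem_univ i)
    obtain ⟨i, hi⟩ := hlt
    obtain ⟨j, hj⟩ := hgt
    have hij : i ≠ j := by rintro rfl; linarith
    obtain ⟨x, y, hx, hxy⟩ := exists_rotation hi hj
    let d₁ : Fin K → Fin n → ℝ := Function.update (Function.update d i x) j y
    have h_i : d₁ i = x := by simp [d₁, hij]
    have h_j : d₁ j = y := by simp [d₁]
    have h_k : ∀ k, k ≠ i → k ≠ j → d₁ k = d k := fun k h h' => by simp [d₁, h, h']
    have hS : ∑ i, vecMulVec (d₁ i) (d₁ i) = ∑ i, vecMulVec (d i) (d i) := by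
      have hji : j ∈ Finset.univ.erase i := by simp [hij.symm]
      rw [← Finset.add_sum_erase _ _ (Finset.mem_univ i), ← Finset.add_sum_erase _ _ hji,
        ← Finset.add_sum_erase _ (fun i => vecMulVec (d i) (d i)) (Finset.mem_univ i),
        ← Finset.add_sum_erase _ (fun i => vecMulVec (d i) (d i)) hji, h_i, h_j,
        ← add_assoc, hxy, add_assoc]
      congr 2
      refine Finset.sum_congr rfl fun k hk => ?_
      rw [h_k k (by aesop) (by aesop)]
    have hT : ∑ i, d₁ i ⬝ᵥ d₁ i = K := by
      rw [← hd]
      simpa [trace_sum, trace_vecMulVec] using congrArg trace hS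
    have hcard : (Finset.univ.filter fun i => d₁ i ⬝ᵥ d₁ i ≠ 1).card < m := by
      rw [← hm]
      refine Finset.card_lt_card (Finset.ssubset_iff_of_subset ?_ |>.2 ⟨i, ?_, ?_⟩)
      · intro k
        simp only [Finset.mem_filter, Finset.mem_univ, true_and]
        intro hk
        by_cases h : k = i
        · subst h; exact hi.ne
        by_cases h' : k = j
        · subst h'; exact hj.ne'
        rwa [h_k k h h'] at hk
      · simpa using hi.ne
      · simp [h_i, hx]
    obtain ⟨d', h1, h2⟩ := ih _ hcard d₁ hT rfl
    exact ⟨d', h1, h2.trans hS⟩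

/-- A positive semidefinite matrix of trace `K` and size at most `K` is the frame matrix of a
family of `K` unit vectors. -/
theorem exists_unit_frame (hnK : n ≤ K) {S : Matrix (Fin n) (Fin n) ℝ} (hS : S.PosSemidef)
    (htr : S.trace = K) :
    ∃ d : Fin K → EuclideanSpace ℝ (Fin n), (∀ i, inner ℝ (d i) (d i) = (1 : ℝ)) ∧
      ∑ i, vecMulVec (d i) (d i) = S := by
  let T := CFC.sqrt S
  have hT : T * T = S := CFC.sqrt_mul_sqrt_self S hS.nonneg
  have hTs : Tᵀ = T := by
    have := (CFC.sqrt_nonneg S).isSelfAdjoint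
    simpa [IsSelfAdjoint, star_eq_conjTranspose] using this
  -- The rows of `√S`, padded with `K - n` zero vectors.
  let d₀ : Fin K → Fin n → ℝ := fun i => if h : (i : ℕ) < n then T ⟨i, h⟩ else 0
  have hd₀ : ∑ i, vecMulVec (d₀ i) (d₀ i) = S := by
    obtain ⟨m, rfl⟩ := Nat.exists_eq_add_of_le hnK
    rw [Fin.sum_univ_add]
    ext a b
    have : ∀ i, T i a = T a i := fun i => by conv_rhs => rw [← hTs, transpose_apply]
    simp [d₀, ← hT, Matrix.mul_apply, Matrix.sum_apply, vecMulVec_apply, this]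
  obtain ⟨d, h1, h2⟩ := exists_unit_family d₀ (by
    rw [← htr, ← hd₀]; simp [trace_sum, trace_vecMulVec])
  refine ⟨fun i => WithLp.toLp 2 (d i), fun i => ?_, h2.trans hd₀⟩
  simp only [EuclideanSpace.inner_eq_star_dotProduct, star_trivial]
  exact h1 i

/-! ### First and second moments of the centered vector. -/

/-- The centered random vector `V - 𝔼 V`, in coordinates. -/
noncomputable def centered (P : Measure Ω) (V : Ω → EuclideanSpace ℝ (Fin n)) (ω : Ω) :
    Fin n → ℝ :=
  fun j => V ω j - ∫ ω', V ω' j ∂P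

/-- The matrix whose columns are the vectors of `d`. -/
def synthesis (d : Fin K → EuclideanSpace ℝ (Fin n)) : Matrix (Fin n) (Fin K) ℝ :=
  Matrix.of fun j i => d i j

theorem synthesis_mul_transpose (d : Fin K → EuclideanSpace ℝ (Fin n)) :
    synthesis d * (synthesis d)ᵀ = ∑ i, vecMulVec (d i) (d i) := by
  ext a b
  simp [synthesis, Matrix.mul_apply, Matrix.sum_apply, vecMulVec_apply]

theorem synthesis_mulVec (d : Fin K → EuclideanSpace ℝ (Fin n)) (x : Fin K → ℝ) :
    synthesis d *ᵥ x = (∑ i, x i • d i : EuclideanSpace ℝ (Fin n)) := by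
  ext a
  simp [synthesis, Matrix.mulVec, dotProduct, mul_comm]

theorem zero_le_dotProduct_self {m : ℕ} (x : Fin m → ℝ) : 0 ≤ x ⬝ᵥ x :=
  Finset.sum_nonneg fun _ _ => mul_self_nonneg _

theorem dotProduct_self_mulVec {m : ℕ} (G : Matrix (Fin m) (Fin n) ℝ) (w : Fin n → ℝ) :
    (G *ᵥ w) ⬝ᵥ (G *ᵥ w) = w ⬝ᵥ (Gᵀ * G) *ᵥ w := by
  rw [← mulVec_mulVec, dotProduct_mulVec w, vecMul_transpose]

section moments

variable {P : Measure Ω} {V : Ω → EuclideanSpace ℝ (Fin n)}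

theorem memLp_coord (hV : MemLp V 2 P) (j : Fin n) : MemLp (fun ω => V ω j) 2 P :=
  (EuclideanSpace.proj (𝕜 := ℝ) j).comp_memLp' hV

theorem varMatrix_isSymm : (varMatrix P V)ᵀ = varMatrix P V := by
  ext i j
  exact covariance_comm _ _

variable [IsProbabilityMeasure P]

theorem memLp_centered (hV : MemLp V 2 P) (j : Fin n) :
    MemLp (fun ω => centered P V ω j) 2 P :=
  (memLp_coord hV j).sub (memLp_const _)

theorem memLp_mulVec_centered {m : ℕ} (hV : MemLp V 2 P) (G : Matrix (Fin m) (Fin n) ℝ)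
    (i : Fin m) : MemLp (fun ω => (G *ᵥ centered P V ω) i) 2 P := by
  simp only [Matrix.mulVec, dotProduct]
  exact memLp_finsetSum _ fun j _ => (memLp_centered hV j).const_mul _

theorem integral_centered (hV : MemLp V 2 P) (j : Fin n) : ∫ ω, centered P V ω j ∂P = 0 := by
  simp only [centered]
  rw [integral_sub ((memLp_coord hV j).integrable (by norm_num)) (integrable_const _)]
  simp

theorem integrable_linear (hV : MemLp V 2 P) (u : Fin n → ℝ) :
    Integrable (fun ω => u ⬝ᵥ centered P V ω) P := by
  simp only [dotProduct]
  exact integrable_finsetSum _ fun j _ =>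
    ((memLp_centered hV j).integrable (by norm_num)).const_mul _

theorem integral_linear (hV : MemLp V 2 P) (u : Fin n → ℝ) :
    ∫ ω, u ⬝ᵥ centered P V ω ∂P = 0 := by
  simp only [dotProduct]
  rw [integral_finsetSum _ fun j _ =>
    ((memLp_centered hV j).integrable (by norm_num)).const_mul _]
  simp [integral_const_mul, integral_centered hV]

theorem integrable_quadratic (hV : MemLp V 2 P) (M : Matrix (Fin n) (Fin n) ℝ) :
    Integrable (fun ω => centered P V ω ⬝ᵥ M *ᵥ centered P V ω) P := by
  simp only [dotProduct]
  exact integrable_finsetSum _ fun j _ =>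
    (memLp_centered hV j).integrable_mul (memLp_mulVec_centered hV M j)

/-- The expectation of a quadratic form of a centered random vector. -/
theorem integral_quadratic (hV : MemLp V 2 P) (M : Matrix (Fin n) (Fin n) ℝ) :
    ∫ ω, centered P V ω ⬝ᵥ M *ᵥ centered P V ω ∂P = (M * varMatrix P V).trace := by
  have hint : ∀ i j, Integrable (fun ω => centered P V ω i * (M i j * centered P V ω j)) P :=
    fun i j => (memLp_centered hV i).integrable_mul ((memLp_centered hV j).const_mul _)
  simp only [dotProduct, Matrix.mulVec, Finset.mul_sum]
  rw [integral_finsetSum _ fun i _ => integrable_finsetSum _ fun j _ => hint i j]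
  simp only [Matrix.trace, Matrix.diag, Matrix.mul_apply]
  refine Finset.sum_congr rfl fun i _ => ?_
  rw [integral_finsetSum _ fun j _ => hint i j]
  refine Finset.sum_congr rfl fun j _ => ?_
  simp only [varMatrix, of_apply, covariance, ← integral_const_mul, centered]
  exact integral_congr_ae (.of_forall fun ω => by ring)

theorem varMatrix_posSemidef (hV : MemLp V 2 P) : (varMatrix P V).PosSemidef := by
  refine Matrix.PosSemidef.of_dotProduct_mulVec_nonneg
    (by rw [IsHermitian, conjTranspose_eq_transpose_of_trivial, varMatrix_isSymm]) fun x => ?_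
  -- With `M = x xᵀ` the quadratic form is the square of `⟨x, W⟩`.
  have h := integral_quadratic hV (vecMulVec x x)
  rw [vecMulVec_mul, trace_vecMulVec, dotProduct_comm, ← dotProduct_mulVec] at h
  rw [star_trivial, ← h]
  refine integral_nonneg fun ω => ?_
  simp only [vecMulVec_mulVec, dotProduct_smul, Pi.zero_apply]
  simp only [MulOpposite.smul_eq_mul_unop, MulOpposite.unop_op, dotProduct_comm x]
  exact mul_self_nonneg _

/-- A linear map which annihilates the covariance matrix annihilates the centered vector. -/
theorem ae_mulVec_centered_eq_zero {m : ℕ} (hV : MemLp V 2 P) {G : Matrix (Fin m) (Fin n) ℝ}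
    (hG : G * varMatrix P V = 0) : ∀ᵐ ω ∂P, G *ᵥ centered P V ω = 0 := by
  have h0 : ∫ ω, (G *ᵥ centered P V ω) ⬝ᵥ (G *ᵥ centered P V ω) ∂P = 0 := by
    simp only [dotProduct_self_mulVec]
    rw [integral_quadratic hV, Matrix.mul_assoc, hG, Matrix.mul_zero, trace_zero]
  have hint : Integrable (fun ω => (G *ᵥ centered P V ω) ⬝ᵥ (G *ᵥ centered P V ω)) P := by
    simp only [dotProduct_self_mulVec]
    exact integrable_quadratic hV _
  rw [integral_eq_zero_iff_of_nonneg (fun ω => zero_le_dotProduct_self _) hint] at h0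
  filter_upwards [h0] with ω hω
  exact dotProduct_self_eq_zero.1 hω

/-! ### Comparison of a scheme with a linear one. -/

/-- The cost of a feasible scheme, compared with the linear scheme `Dᵀ Y (V - 𝔼 V)`. -/
theorem integral_sq_sub_linear (hV : MemLp V 2 P) {c : EuclideanSpace ℝ (Fin n)}
    {d : Fin K → EuclideanSpace ℝ (Fin n)}
    {f : EuclideanSpace ℝ (Fin n) → EuclideanSpace ℝ (Fin K)}
    (hf : IsFeasibleScheme P V c d f) (hcost : cost P V f ≠ ∞) (Y : Matrix (Fin n) (Fin n) ℝ) :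
    let r : Ω → Fin K → ℝ := fun ω => f (V ω) - ((synthesis d)ᵀ * Y) *ᵥ centered P V ω
    Integrable (fun ω => r ω ⬝ᵥ r ω) P ∧
      ∫ ω, r ω ⬝ᵥ r ω ∂P = (cost P V f).toReal - 2 * (Y * varMatrix P V).trace +
        (Yᵀ * (synthesis d * (synthesis d)ᵀ) * Y * varMatrix P V).trace := by
  generalize hDd : synthesis d = D
  intro r
  -- The bias `𝔼V - c`; it enters only through a linear term in `W`, whose mean is zero.
  let m : Fin n → ℝ := fun j => (∫ ω', V ω' j ∂P) - c j
  have hmeas : AEStronglyMeasurable (fun ω => inner ℝ (f (V ω)) (f (V ω))) P := by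
    have : AEMeasurable (fun ω => f (V ω)) P := hf.1.comp_aemeasurable hV.1.aemeasurable
    exact (this.inner this).aestronglyMeasurable
  have hnn : 0 ≤ᵐ[P] fun ω => inner ℝ (f (V ω)) (f (V ω)) :=
    .of_forall fun ω => real_inner_self_nonneg
  have hintf : Integrable (fun ω => inner ℝ (f (V ω)) (f (V ω))) P :=
    ⟨hmeas, by rw [hasFiniteIntegral_iff_ofReal hnn]; exact lt_top_iff_ne_top.2 hcost⟩
  have hcosteq : (cost P V f).toReal = ∫ ω, inner ℝ (f (V ω)) (f (V ω)) ∂P := by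
    rw [integral_eq_lintegral_of_nonneg_ae hnn hmeas, cost]
  have hpt : (fun ω => r ω ⬝ᵥ r ω) =ᵐ[P] fun ω =>
      inner ℝ (f (V ω)) (f (V ω)) - 2 * (centered P V ω ⬝ᵥ Y *ᵥ centered P V ω)
        - 2 * ((m ᵥ* Y) ⬝ᵥ centered P V ω)
        + centered P V ω ⬝ᵥ (Yᵀ * (D * Dᵀ) * Y) *ᵥ centered P V ω := by
    filter_upwards [hf.2] with ω hω
    have hD : D *ᵥ (f (V ω)) = centered P V ω + m := by
      rw [← hDd, synthesis_mulVec, ← hω]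
      ext j
      simp [centered, m]
    -- Moving `Dᵀ` across turns `f` into `D f`, which feasibility determines; the cross term thus no
    -- longer depends on `f`.
    have h1 : (f (V ω) : Fin K → ℝ) ⬝ᵥ (Dᵀ * Y) *ᵥ centered P V ω =
        centered P V ω ⬝ᵥ Y *ᵥ centered P V ω + (m ᵥ* Y) ⬝ᵥ centered P V ω := by
      rw [← mulVec_mulVec, dotProduct_mulVec, vecMul_transpose, hD, add_dotProduct,
        dotProduct_mulVec m]
    have h2 := dotProduct_self_mulVec (Dᵀ * Y) (centered P V ω)
    rw [transpose_mul, transpose_transpose, Matrix.mul_assoc, ← Matrix.mul_assoc D,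
      ← Matrix.mul_assoc] at h2
    have h3 : inner ℝ (f (V ω)) (f (V ω)) = (f (V ω) : Fin K → ℝ) ⬝ᵥ f (V ω) := by
      simp only [EuclideanSpace.inner_eq_star_dotProduct, star_trivial]
    simp only [r, sub_dotProduct, dotProduct_sub, h3]
    rw [dotProduct_comm ((Dᵀ * Y) *ᵥ centered P V ω) (f (V ω) : Fin K → ℝ), h1, h2]
    ring
  have i1 := (integrable_quadratic hV Y).const_mul 2
  have i2 := (integrable_linear hV (m ᵥ* Y)).const_mul 2
  have i3 := integrable_quadratic hV (Yᵀ * (D * Dᵀ) * Y)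
  have i4 := hintf.sub' i1
  have i5 := i4.sub' i2
  refine ⟨(i5.fun_add i3).congr hpt.symm, ?_⟩
  rw [integral_congr_ae hpt, integral_add i5 i3, integral_sub i4 i2, integral_sub hintf i1,
    integral_const_mul, integral_const_mul, integral_linear hV, integral_quadratic hV,
    integral_quadratic hV, hcosteq]
  ring

/-- A linear map which annihilates the centered vector annihilates the covariance matrix. -/
theorem mul_varMatrix_eq_zero {m : ℕ} (hV : MemLp V 2 P) {G : Matrix (Fin m) (Fin n) ℝ}
    (hG : ∀ᵐ ω ∂P, G *ᵥ centered P V ω = 0) : G * varMatrix P V = 0 := by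
  rw [← trace_conjTranspose_mul_self_eq_zero_iff, ← Matrix.mul_assoc, ← integral_quadratic hV]
  refine integral_eq_zero_of_ae ?_
  filter_upwards [hG] with ω hω
  simp [← mulVec_mulVec, hω]

end moments

theorem trace_frame_mul (d : Fin K → EuclideanSpace ℝ (Fin n)) (M : Matrix (Fin n) (Fin n) ℝ) :
    (∑ i, vecMulVec (d i) (d i) * M).trace = ∑ i, (d i : Fin n → ℝ) ⬝ᵥ M *ᵥ d i := by
  rw [trace_sum]
  refine Finset.sum_congr rfl fun i _ => ?_
  rw [vecMulVec_mul, trace_vecMulVec, dotProduct_comm, ← dotProduct_mulVec]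

theorem IsDictionary.dotProduct_self {ℓ : Fin K → ℝ} {d : Fin K → EuclideanSpace ℝ (Fin n)}
    (hd : IsDictionary ℓ d) (i : Fin K) : (d i : Fin n → ℝ) ⬝ᵥ d i = ℓ i := by
  rw [← hd i]
  simp only [EuclideanSpace.inner_eq_star_dotProduct, star_trivial]

section

variable {P : Measure Ω} {V : Ω → EuclideanSpace ℝ (Fin n)}

/-- The span constraint on the dictionary follows from the existence of a scheme. -/
theorem IsFeasibleScheme.shiftedSupport_subset_span (hV : AEMeasurable V P)
    {c : EuclideanSpace ℝ (Fin n)} {d : Fin K → EuclideanSpace ℝ (Fin n)}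
    {f : EuclideanSpace ℝ (Fin n) → EuclideanSpace ℝ (Fin K)} (hf : IsFeasibleScheme P V c d f) :
    shiftedSupport P V c ⊆ (Submodule.span ℝ (Set.range d) : Set (EuclideanSpace ℝ (Fin n))) := by
  -- A closed set of full measure, hence one containing the support.
  let t : Set (EuclideanSpace ℝ (Fin n)) :=
    (fun v => v - c) ⁻¹' (Submodule.span ℝ (Set.range d) : Set (EuclideanSpace ℝ (Fin n)))
  have ht : IsClosed t :=
    (Submodule.closed_of_finiteDimensional _).preimage (by fun_prop)
  have hae : t ∈ ae (P.map V) := by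
    refine (ae_map_iff (p := fun v => v ∈ t) hV ht.measurableSet).2 ?_
    filter_upwards [hf.2] with ω hω
    simp only [t, Set.mem_preimage, hω]
    exact Submodule.sum_mem _ fun i _ =>
      Submodule.smul_mem _ _ (Submodule.subset_span (Set.mem_range_self i))
  intro v hv
  have := Measure.support_subset_of_isClosed ht hae hv
  simpa [t] using this

variable [IsProbabilityMeasure P]

/-- A positive semidefinite matrix of trace zero vanishes; the covariance would then be zero and `V`
equal to its mean almost surely. -/
theorem trace_sqrt_varMatrix_pos (hV : MemLp V 2 P)
    (hV_nonconst : ∀ c : EuclideanSpace ℝ (Fin n), ¬ ∀ᵐ ω ∂P, V ω = c) :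
    0 < (CFC.sqrt (varMatrix P V)).trace := by
  have hA : (CFC.sqrt (varMatrix P V)).PosSemidef :=
    nonneg_iff_posSemidef.1 (CFC.sqrt_nonneg _)
  refine lt_of_le_of_ne hA.trace_nonneg fun h => ?_
  have h0 : CFC.sqrt (varMatrix P V) = 0 := hA.trace_eq_zero_iff.1 h.symm
  have hS : varMatrix P V = 0 := by
    rw [← CFC.sqrt_mul_sqrt_self (varMatrix P V) (varMatrix_posSemidef hV).nonneg, h0, mul_zero]
  have := ae_mulVec_centered_eq_zero hV (G := 1) (by rw [hS, mul_zero])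
  refine hV_nonconst (WithLp.toLp 2 fun j => ∫ ω', V ω' j ∂P) ?_
  filter_upwards [this] with ω hω
  ext j
  simpa [centered, sub_eq_zero] using congrFun hω j

/-! ### The lower bound, its equality case and its attainment. -/

/-- The excess of the cost of a feasible scheme over the optimal value, as a sum of squares;
`A` is the square root of the covariance matrix and `B` is its pseudo-inverse. -/
theorem cost_toReal_eq (hV : MemLp V 2 P) {c : EuclideanSpace ℝ (Fin n)}
    {d : Fin K → EuclideanSpace ℝ (Fin n)}
    {f : EuclideanSpace ℝ (Fin n) → EuclideanSpace ℝ (Fin K)}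
    (hd : IsDictionary (fun _ => 1) d) (hf : IsFeasibleScheme P V c d f)
    (hcost : cost P V f ≠ ∞) (hK : K ≠ 0) {A B : Matrix (Fin n) (Fin n) ℝ} (hA : Aᵀ = A)
    (hB : Bᵀ = B) (hAB : A * B = B * A) (hABA : A * B * A = A) (hAA : A * A = varMatrix P V) :
    let r : Ω → Fin K → ℝ := fun ω =>
      f (V ω) - ((synthesis d)ᵀ * ((A.trace / K) • B)) *ᵥ centered P V ω
    let q : Fin K → Fin n → ℝ := fun i => (1 - A * B) *ᵥ d i
    Integrable (fun ω => r ω ⬝ᵥ r ω) P ∧ (cost P V f).toReal =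
      A.trace ^ 2 / K + ∫ ω, r ω ⬝ᵥ r ω ∂P + (A.trace / K) ^ 2 * ∑ i, q i ⬝ᵥ q i := by
  intro r q
  obtain ⟨h1, h2⟩ := integral_sq_sub_linear hV hf hcost ((A.trace / K) • B)
  refine ⟨h1, ?_⟩
  set S := ∑ i, vecMulVec (d i) (d i) with hS
  have t1 : (B * varMatrix P V).trace = A.trace := by
    rw [← hAA, ← Matrix.mul_assoc, ← hAB, hABA]
  have t2 : (B * S * B * varMatrix P V).trace = (S * (A * B)).trace := by
    rw [Matrix.mul_assoc, Matrix.mul_assoc, trace_mul_comm, ← hAA, Matrix.mul_assoc,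
      ← Matrix.mul_assoc B A A, ← hAB, hABA]
  -- `A * B` is the orthogonal projection onto the range of `A`, so `1 - A * B` is one too.
  have hQ : (1 - A * B)ᵀ * (1 - A * B) = 1 - A * B := by
    have : (A * B)ᵀ = A * B := by rw [transpose_mul, hA, hB, hAB]
    have h' : A * B * (A * B) = A * B := by rw [← Matrix.mul_assoc, hABA]
    rw [transpose_sub, this, transpose_one, Matrix.sub_mul, Matrix.mul_sub, Matrix.mul_sub, h']
    simp
  have t3 : ∑ i, q i ⬝ᵥ q i = K - (S * (A * B)).trace := by
    simp only [q, dotProduct_self_mulVec, hQ]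
    simp only [sub_mulVec, dotProduct_sub, one_mulVec, Finset.sum_sub_distrib,
      hd.dotProduct_self]
    rw [hS, Finset.sum_mul, trace_frame_mul]
    simp
  change ∫ ω, r ω ⬝ᵥ r ω ∂P = _ at h2
  rw [synthesis_mul_transpose, ← hS] at h2
  simp only [transpose_smul, hB, Matrix.smul_mul, Matrix.mul_smul, trace_smul, smul_eq_mul, t1,
    t2] at h2
  have hK' : (K : ℝ) ≠ 0 := by exact_mod_cast hK
  rw [t3]
  rw [h2]
  field_simp
  ring

theorem le_cost (hV : MemLp V 2 P) {c : EuclideanSpace ℝ (Fin n)}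
    {d : Fin K → EuclideanSpace ℝ (Fin n)}
    {f : EuclideanSpace ℝ (Fin n) → EuclideanSpace ℝ (Fin K)}
    (hd : IsDictionary (fun _ => 1) d) (hf : IsFeasibleScheme P V c d f) (hK : K ≠ 0)
    {A B : Matrix (Fin n) (Fin n) ℝ} (hA : Aᵀ = A)
    (hB : Bᵀ = B) (hAB : A * B = B * A) (hABA : A * B * A = A) (hAA : A * A = varMatrix P V) :
    ENNReal.ofReal (A.trace ^ 2 / K) ≤ cost P V f := by
  by_cases hcost : cost P V f = ∞
  · simp [hcost]
  obtain ⟨-, h⟩ := cost_toReal_eq hV hd hf hcost hK hA hB hAB hABA hAA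
  refine ENNReal.ofReal_le_of_le_toReal ?_
  rw [h, add_assoc]
  refine le_add_of_nonneg_right (add_nonneg (integral_nonneg fun ω => ?_) (mul_nonneg
    (sq_nonneg _) (Finset.sum_nonneg fun i _ => ?_)))
  all_goals exact zero_le_dotProduct_self _

/-- A dictionary attaining the lower bound for the cost is a frame proportional to the square
root of the covariance matrix. -/
theorem frame_eq_of_cost_le (hV : MemLp V 2 P) {c : EuclideanSpace ℝ (Fin n)}
    {d : Fin K → EuclideanSpace ℝ (Fin n)}
    {f : EuclideanSpace ℝ (Fin n) → EuclideanSpace ℝ (Fin K)}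
    (hd : IsDictionary (fun _ => 1) d) (hf : IsFeasibleScheme P V c d f) (hK : K ≠ 0)
    {A B : Matrix (Fin n) (Fin n) ℝ} (hA : Aᵀ = A)
    (hB : Bᵀ = B) (hAB : A * B = B * A) (hABA : A * B * A = A) (hAA : A * A = varMatrix P V)
    (hpos : 0 < A.trace) (hle : cost P V f ≤ ENNReal.ofReal (A.trace ^ 2 / K)) :
    ∑ i, vecMulVec (d i) (d i) = ((K : ℝ) / A.trace) • A := by
  have hcost : cost P V f ≠ ∞ := (hle.trans_lt ENNReal.ofReal_lt_top).ne
  obtain ⟨hint, h⟩ := cost_toReal_eq hV hd hf hcost hK hA hB hAB hABA hAA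
  have hle' := ENNReal.toReal_le_of_le_ofReal (by positivity) hle
  set l := A.trace / K with hl
  have hK' : (K : ℝ) ≠ 0 := by exact_mod_cast hK
  have hl0 : l ≠ 0 := div_ne_zero hpos.ne' hK'
  let r : Ω → Fin K → ℝ := fun ω => f (V ω) - ((synthesis d)ᵀ * (l • B)) *ᵥ centered P V ω
  have hr0 : 0 ≤ ∫ ω, r ω ⬝ᵥ r ω ∂P := integral_nonneg fun ω => zero_le_dotProduct_self (r ω)
  change _ = _ + ∫ ω, r ω ⬝ᵥ r ω ∂P + _ at h
  have hq0 := Finset.sum_nonneg fun i (_ : i ∈ Finset.univ) =>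
    zero_le_dotProduct_self ((1 - A * B) *ᵥ d i)
  have hlq := mul_nonneg (sq_nonneg l) hq0
  -- At the lower bound both nonnegative excess terms vanish.
  have hq : ∑ i, ((1 - A * B) *ᵥ d i) ⬝ᵥ ((1 - A * B) *ᵥ d i) = 0 := by
    refine (mul_eq_zero.1 (?_ : l ^ 2 * _ = 0)).resolve_left (pow_ne_zero 2 hl0)
    linarith
  have hr := (integral_eq_zero_iff_of_nonneg (fun ω => zero_le_dotProduct_self _) hint).1
    (by linarith)
  set S := ∑ i, vecMulVec (d i) (d i) with hS
  have hSP : S * (A * B) = S := by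
    have hPS : (1 - A * B) * S = 0 := by
      rw [hS, Finset.mul_sum]
      refine Finset.sum_eq_zero fun i hi => ?_
      rw [mul_vecMulVec, dotProduct_self_eq_zero.1
        ((Finset.sum_eq_zero_iff_of_nonneg fun i _ => zero_le_dotProduct_self _).1 hq i hi),
        zero_vecMulVec]
    have hSt : Sᵀ = S := by simp [hS, transpose_sum]
    have := congrArg transpose hPS
    rw [transpose_mul, hSt, transpose_sub, transpose_mul, hA, hB, transpose_one, ← hAB,
      Matrix.mul_sub, Matrix.mul_one, transpose_zero, sub_eq_zero] at this
    exact this.symm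
  -- Applying `D` to `f = λ Dᵀ B W` gives `λ S B W = V - c`.
  have hW : ∀ᵐ ω ∂P, (l • (S * B) - 1) *ᵥ centered P V ω =
      fun j => (∫ ω', V ω' j ∂P) - c j := by
    filter_upwards [hf.2, hr] with ω hω hrω
    have h1 := sub_eq_zero.1 (dotProduct_self_eq_zero.1 hrω)
    have h2 := synthesis_mulVec d (f (V ω))
    rw [h1, mulVec_mulVec, ← Matrix.mul_assoc, synthesis_mul_transpose, ← hS, ← h1, ← hω,
      Matrix.mul_smul] at h2
    rw [sub_mulVec, h2, one_mulVec]
    ext j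
    simp [centered]
  have hW0 : ∀ᵐ ω ∂P, (l • (S * B) - 1) *ᵥ centered P V ω = 0 := by
    -- The left side of `hW` has mean zero, so its constant value is zero: an optimal `c` is `𝔼V`.
    have hm : (fun j => (∫ ω', V ω' j ∂P) - c j) = 0 := by
      ext j
      have h1 : ∫ ω, ((l • (S * B) - 1) *ᵥ centered P V ω) j ∂P = 0 := integral_linear hV _
      rw [integral_congr_ae (g := fun _ => (∫ ω', V ω' j ∂P) - c j)
        (hW.mono fun ω hω => congrFun hω j)] at h1
      simpa using h1
    rwa [hm] at hW
  have h0 := mul_varMatrix_eq_zero hV hW0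
  rw [Matrix.sub_mul, Matrix.one_mul, sub_eq_zero, ← hAA, Matrix.smul_mul, Matrix.mul_assoc,
    ← Matrix.mul_assoc B, ← hAB, hABA] at h0
  -- Here `h0` reads `λ S A = A²`; multiplying by `B` on the right turns it into `λ S = A`.
  have h1 := congrArg (· * B) h0
  simp only [Matrix.smul_mul, Matrix.mul_assoc, hSP] at h1
  rw [hAB, ← Matrix.mul_assoc, hABA] at h1
  have hl' : (K : ℝ) / A.trace * l = 1 := by rw [hl]; field_simp
  calc S = ((K : ℝ) / A.trace * l) • S := by rw [hl', one_smul]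
    _ = ((K : ℝ) / A.trace) • A := by rw [mul_smul, h1]

/-- A dictionary whose frame matrix is proportional to the square root of the covariance matrix
attains the lower bound for the cost. -/
theorem exists_isFeasible_cost_eq (hV : MemLp V 2 P) {d : Fin K → EuclideanSpace ℝ (Fin n)}
    (hd : IsDictionary (fun _ => 1) d) (hK : K ≠ 0)
    {A B : Matrix (Fin n) (Fin n) ℝ}
    (hB : Bᵀ = B) (hAB : A * B = B * A) (hABA : A * B * A = A) (hAA : A * A = varMatrix P V)
    (hpos : 0 < A.trace) (hS : ∑ i, vecMulVec (d i) (d i) = ((K : ℝ) / A.trace) • A) :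
    ∃ c f, IsFeasible P V (fun _ => 1) c d f ∧
      cost P V f = ENNReal.ofReal (A.trace ^ 2 / K) := by
  have hK' : (K : ℝ) ≠ 0 := by exact_mod_cast hK
  have hl : A.trace / K * (K / A.trace) = 1 := by field_simp
  let μ : Fin n → ℝ := fun j => ∫ ω, V ω j ∂P
  let G : Matrix (Fin K) (Fin n) ℝ := (synthesis d)ᵀ * ((A.trace / K) • B)
  let f : EuclideanSpace ℝ (Fin n) → EuclideanSpace ℝ (Fin K) := fun v =>
    WithLp.toLp 2 (G *ᵥ ((v : Fin n → ℝ) - μ))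
  have hfV : ∀ ω, (f (V ω) : Fin K → ℝ) = G *ᵥ centered P V ω := fun ω => rfl
  have hDG : synthesis d * G = A * B := by
    simp only [G]
    rw [← Matrix.mul_assoc, synthesis_mul_transpose, hS, Matrix.smul_mul, Matrix.mul_smul,
      smul_smul, mul_comm, hl, one_smul]
  have hf : IsFeasibleScheme P V (WithLp.toLp 2 μ) d f := by
    refine ⟨?_, ?_⟩
    · have : Continuous f := by
        refine (PiLp.continuous_toLp 2 _).comp (Continuous.matrix_mulVec continuous_const ?_)
        exact (PiLp.continuous_ofLp 2 _).sub continuous_const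
      exact this.measurable
    -- `W` lies almost surely in the range of `A`, where `D G = A B` acts as the identity.
    · have h0 : (1 - A * B) * varMatrix P V = 0 := by
        rw [← hAA, ← Matrix.mul_assoc, Matrix.sub_mul, hABA, Matrix.one_mul, sub_self,
          Matrix.zero_mul]
      filter_upwards [ae_mulVec_centered_eq_zero hV h0] with ω hω
      rw [sub_mulVec, one_mulVec, sub_eq_zero, ← hDG, ← mulVec_mulVec, ← hfV,
        synthesis_mulVec] at hω
      ext j
      rw [← hω]
      rfl
  refine ⟨WithLp.toLp 2 μ, f, ⟨⟨hd, hf.shiftedSupport_subset_span hV.1.aemeasurable⟩, hf⟩, ?_⟩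
  have hin : ∀ ω, inner ℝ (f (V ω)) (f (V ω)) =
      centered P V ω ⬝ᵥ (Gᵀ * G) *ᵥ centered P V ω := fun ω => by
    simp only [EuclideanSpace.inner_eq_star_dotProduct, star_trivial, hfV, dotProduct_self_mulVec]
  have htr : (Gᵀ * G * varMatrix P V).trace = A.trace ^ 2 / K := by
    have : Gᵀ * G = (A.trace / K) • (B * (A * B)) := by
      rw [← hDG]
      simp only [G, transpose_mul, transpose_transpose, transpose_smul, hB, Matrix.mul_assoc,
        Matrix.smul_mul]
    have h5 : B * (A * B) * (A * A) = A := calc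
      B * (A * B) * (A * A) = B * (A * B * A) * A := by simp only [Matrix.mul_assoc]
      _ = A := by rw [hABA, ← hAB, hABA]
    rw [this, ← hAA, Matrix.smul_mul, h5, trace_smul]
    simp only [smul_eq_mul]
    ring
  rw [cost, ← htr, ← integral_quadratic hV, ofReal_integral_eq_lintegral_ofReal
    (integrable_quadratic hV _) (.of_forall fun ω => by
      simp only [← hin]; exact real_inner_self_nonneg)]
  simp only [hin]

end

end L2Dictionary


open L2Dictionary in
theorem mainTheorem3 {Ω : Type*} [MeasurableSpace Ω] (P : Measure Ω) [IsProbabilityMeasure P]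
    {n K : ℕ} (hnK : n ≤ K)
    (V : Ω → EuclideanSpace ℝ (Fin n)) (hV : MemLp V 2 P)
    (hV_nonconst : ∀ c : EuclideanSpace ℝ (Fin n), ¬ ∀ᵐ ω ∂P, V ω = c)
    (ℓ : Fin K → ℝ) (hℓ : ∀ i, ℓ i = 1)
    (d : Fin K → EuclideanSpace ℝ (Fin n)) (hd : L2Dictionary.IsDictionary ℓ d) :
    L2Dictionary.IsL2Optimal P V ℓ d ↔
      ∑ i, Matrix.vecMulVec (d i) (d i) =
        ((K : ℝ) / (CFC.sqrt (L2Dictionary.varMatrix P V)).trace) •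
          CFC.sqrt (L2Dictionary.varMatrix P V) := by
  obtain rfl : ℓ = fun _ => 1 := funext hℓ
  have hpos := trace_sqrt_varMatrix_pos hV hV_nonconst
  have hAA := CFC.sqrt_mul_sqrt_self (varMatrix P V) (varMatrix_posSemidef hV).nonneg
  have hApsd : (CFC.sqrt (varMatrix P V)).PosSemidef :=
    Matrix.nonneg_iff_posSemidef.1 (CFC.sqrt_nonneg _)
  generalize CFC.sqrt (varMatrix P V) = A at *
  have hA : A.transpose = A := by simpa using hApsd.isHermitian.eq
  have hK : K ≠ 0 := by
    rintro rfl
    obtain rfl : n = 0 := by omega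
    simp at hpos
  obtain ⟨B, hB, hAB, hABA⟩ := exists_pseudoinverse hApsd.isHermitian
  constructor
  · rintro ⟨c, f, hf, hmin⟩
    -- A competitor attaining the bound, so that the minimizer must attain it as well.
    obtain ⟨d₀, hd₀, hS₀⟩ := exists_unit_frame hnK (S := ((K : ℝ) / A.trace) • A)
      (hApsd.smul (by positivity)) (by
        rw [Matrix.trace_smul, smul_eq_mul, div_mul_cancel₀ _ hpos.ne'])
    obtain ⟨c₀, f₀, hf₀, hcost₀⟩ :=
      exists_isFeasible_cost_eq hV hd₀ hK hB hAB hABA hAA hpos hS₀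
    exact frame_eq_of_cost_le hV hd hf.2 hK hA hB hAB hABA hAA hpos
      (hcost₀ ▸ hmin c₀ d₀ f₀ hf₀)
  · intro hS
    obtain ⟨c, f, hf, hcost⟩ := exists_isFeasible_cost_eq hV hd hK hB hAB hABA hAA hpos hS
    refine ⟨c, f, hf, fun c' d' f' hf' => ?_⟩
    rw [hcost]
    exact le_cost hV hf'.1.1 hf'.2 hK hA hB hAB hABA hAA
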